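/- Let $G$ be an arbitrary graph with $n \ge 1$ nodes $[n]$, covered by $\zeta\ge 1$ fixed matchings; in step $\tau = 1,2,\dots$ the matching $\mathbf m(\tau)=\mathbf m(\tau \bmod \zeta)$ is used. We also write $\mathbf m(\tau)$ for the matrix with $\mathbf m(\tau)_{i,i}=1$ if $i$ is unmatched, $\mathbf m(\tau)_{i,i}=\frac12$ if $i$ is matched, $\mathbf m(\tau)_{i,j}=\frac12$ if $i,j$ are matched to each other, and $0$ otherwise. Put $\mathbf m^{[\tau,t]}=\mathbf m(t)\mathbf m(t-1)\cdots\mathbf m(\tau)$ and $$\Upsilon(\mathbf m^{[t]})=\max_{k\in[n]}\sqrt{\sum_{\tau=1}^t\big\|\mathbf m^{[\tau,t]}_{k,\cdot}-\tfrac{\vec 1}{n}\big\|_2^2}.$$ Consider the process that starts from an arbitrary load vector $X(0)\in\mathbb R^n$ and in each step $\tau\ge1$ first allocates $m$ unit-sized items to the nodes independently and uniformly at random, and then, for each edge $\{i,j\}$ of $\mathbf m(\tau)$ (with current loads $x_i\ge x_j$), moves $\lceil\delta\rceil$ items from $i$ to $j$ with probability $\delta-\lfloor\delta\rfloor$ and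 $\lfloor\delta\rfloor$ items otherwise, where $\delta=(x_i-x_j)/2$, independently for the different edges; $X(\tau)$ is the resulting load vector. Let $\operatorname{disc}(x)=\max_i x_i-\min_j x_j$. There are absolute constants $c,p>0$ such that for all $n$, $G$, balancing circuits, $X(0)$, $t\in\mathbb N$ and $m\ge 4n\log (n)/\Upsilon(\mathbf m^{[t]})$, $$\Pr\Big[\operatorname{disc}(X(t))\ge c\,\sqrt{m/n}\cdot\Upsilon(\mathbf m^{[t]})\Big]\ge p,$$ the bound being trivial if $\Upsilon(\mathbf m^{[t]})=0$. Moreover, if $\Upsilon(\mathbf m^{[t]})>0$, then also $$\Pr\Big[\sqrt{\log n}\cdot\operatorname{disc}(X(t))\ge c\,\big(\log n+\sqrt{m/n}\cdot\Upsilon(\mathbf m^{[t]})\cdot\sqrt{\log n}\big)\Big]\ge p,$$ that is, the upper bound $O\big(\log n+\sqrt{m/n}\cdot\Upsilon(\mathbf m^{[t]})\sqrt{\log n}\big)$ for the discrepancy in this model is tight up to a factor $\sqrt{\log n}$. -/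

import Mathlib

open scoped ENNReal

noncomputable section

namespace LoadBalancing

/-- The discrepancy of a load vector: maximum load minus minimum load. -/
def disc {n : ℕ} [NeZero n] (x : Fin n → ℝ) : ℝ :=
  Finset.univ.sup' Finset.univ_nonempty x - Finset.univ.inf' Finset.univ_nonempty x

/-- A balancing circuit on `G` with period `ζ`: a family of `ζ` matchings of `G` which together
cover all the edges of `G`. -/
structure BalancingCircuit {n : ℕ} (G : SimpleGraph (Fin n)) (ζ : ℕ) where
  matching : Fin ζ → G.Subgraph
  isMatching : ∀ i, (matching i).IsMatching
  covers : ∀ u v, G.Adj u v → ∃ i, (matching i).Adj u v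

/-- The matching applied in step `t`, namely the one with index `t mod ζ`. -/
def BalancingCircuit.seq {n : ℕ} {G : SimpleGraph (Fin n)} {ζ : ℕ} [NeZero ζ]
    (C : BalancingCircuit G ζ) (t : ℕ) : G.Subgraph :=
  C.matching (Fin.ofNat ζ t)

section Divergence

variable {n : ℕ} {G : SimpleGraph (Fin n)}

open Classical in
/-- The balancing matrix of a matching: the idealized balancing step with parameter `β`. -/
def mixMatrix (β : ℝ) (M : G.Subgraph) : Matrix (Fin n) (Fin n) ℝ :=
  Matrix.of fun i j =>
    if i = j then (if i ∈ M.verts then 1 - β / 2 else 1)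
    else if M.Adj i j then β / 2 else 0

/-- The mixing matrix `M(t₂) * M(t₂ - 1) * ⋯ * M(t₁)`, where the steps `t₁` and `t₂` are numbered
from `1`; it is the identity if `t₁ > t₂`. -/
def mixProd (β : ℝ) (M : ℕ → G.Subgraph) (t₁ : ℕ) : ℕ → Matrix (Fin n) (Fin n) ℝ
  | 0 => 1
  | t + 1 => if t₁ ≤ t + 1 then mixMatrix β (M (t + 1)) * mixProd β M t₁ t else 1

/-- The divergence of node `k` over the steps `1, …, t`: the square root of the sum over
`τ = 1, …, t` of the squared Euclidean distance between the `k`-th row of the mixing matrix from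
step `τ` to step `t` and the uniform vector `(1/n, …, 1/n)`. -/
def nodeDivergence (β : ℝ) (M : ℕ → G.Subgraph) (t : ℕ) (k : Fin n) : ℝ :=
  √(∑ τ ∈ Finset.Icc 1 t, ∑ w : Fin n, (mixProd β M τ t k w - 1 / (n : ℝ)) ^ 2)

/-- The global divergence: the maximum over all nodes of the divergence of the node. -/
def globalDivergence [NeZero n] (β : ℝ) (M : ℕ → G.Subgraph) (t : ℕ) : ℝ :=
  Finset.univ.sup' Finset.univ_nonempty (nodeDivergence β M t)

end Divergence

section Law

/-- The product of finitely many distributions on a finite type: the law of independent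
coordinates. -/
def piPMF {ι α : Type} [Fintype ι] [DecidableEq ι] [Fintype α] (p : ι → PMF α) : PMF (ι → α) :=
  PMF.ofFintype (fun f => ∏ i, p i (f i)) (by
    rw [← Fintype.prod_sum]
    refine Finset.prod_eq_one fun i _ => ?_
    rw [← tsum_fintype (L := .unconditional α)]
    exact (p i).tsum_coe)

/-- The law of a coin showing `true` with probability `fract δ`, the fractional part of `δ`. -/
def fractCoin (δ : ℝ) : PMF Bool :=
  PMF.ofFintype
    (fun b => if b then ENNReal.ofReal (Int.fract δ) else ENNReal.ofReal (1 - Int.fract δ)) (by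
    simp only [Fintype.sum_bool, if_true, Bool.false_eq_true, if_false]
    rw [← ENNReal.ofReal_add (Int.fract_nonneg δ) (by linarith [Int.fract_lt_one δ])]
    simp)

variable {n : ℕ}

/-- The idealized amount `β |x i - x j| / 2` which is to be sent over the edge `{i, j}`. -/
def idealFlow (β : ℝ) (x : Fin n → ℝ) : Sym2 (Fin n) → ℝ :=
  Sym2.lift ⟨fun i j => β * |x i - x j| / 2, fun i j => by
    dsimp only
    rw [abs_sub_comm]⟩

/-- The number of items sent over an edge with ideal flow `δ`: rounded up if the coin `b` shows
`true`, rounded down otherwise. -/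
def roundFlow (δ : ℝ) (b : Bool) : ℤ := if b then ⌈δ⌉ else ⌊δ⌋

/-- The signed number of items that `i` sends to `j` when the edge `{i, j}` is balanced: the node
with the larger load is the sender. The outcomes of the coins of the edges are given by `ω`. -/
def signedFlow (β : ℝ) (x : Fin n → ℝ) (ω : Sym2 (Fin n) → Bool) (i j : Fin n) : ℤ :=
  if x j ≤ x i then roundFlow (idealFlow β x s(i, j)) (ω s(i, j))
  else -roundFlow (idealFlow β x s(i, j)) (ω s(i, j))

open Classical in
/-- The load vector after balancing over all edges of the matching `M` (the sum has at most one
term, as `M` is a matching). -/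
def balanced {G : SimpleGraph (Fin n)} (β : ℝ) (M : G.Subgraph) (x : Fin n → ℝ)
    (ω : Sym2 (Fin n) → Bool) : Fin n → ℝ :=
  fun i => x i - ∑ j with M.Adj i j, (signedFlow β x ω i j : ℝ)

/-- The randomized balancing step: every edge has its own independent coin, which decides whether
the ideal flow over this edge is rounded up or down, with probability of rounding up equal to the
fractional part of the ideal flow. (The coins of pairs that are not in the matching are unused.) -/
def balanceLaw {G : SimpleGraph (Fin n)} (β : ℝ) (M : G.Subgraph) (x : Fin n → ℝ) :
    PMF (Fin n → ℝ) :=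
  (piPMF fun e : Sym2 (Fin n) => fractCoin (idealFlow β x e)).map (balanced β M x)

open Classical in
/-- The allocation vector when the `j`-th of the `m` items goes to node `a j`. -/
def allocVec {m : ℕ} (a : Fin m → Fin n) : Fin n → ℝ :=
  fun i => ((Finset.univ.filter fun j => a j = i).card : ℝ)

/-- The law of the allocation vector of one step: `m` unit-sized items are allocated to the nodes
uniformly and independently at random. -/
def allocLaw (n : ℕ) [NeZero n] (m : ℕ) : PMF (Fin n → ℝ) :=
  (PMF.uniformOfFintype (Fin m → Fin n)).map allocVec

/-- The law of the state at the end of step `t` of the synchronous process with balancing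
parameter `β` that starts in `x₀`, allocates `m` items in each step and then balances over the
matching `M t` of the step `t = 1, 2, …`. -/
def stateLaw [NeZero n] {G : SimpleGraph (Fin n)} (β : ℝ) (m : ℕ) (M : ℕ → G.Subgraph)
    (x₀ : Fin n → ℝ) : ℕ → PMF (Fin n → ℝ)
  | 0 => PMF.pure x₀
  | t + 1 => (stateLaw β m M x₀ t).bind fun x =>
      (allocLaw n m).bind fun l => balanceLaw β (M (t + 1)) (x + l)

end Law

end LoadBalancing

end

/-!
Let `k` be a node of maximal divergence `Υ`. The deviation of its load from the average load after
step `t` is a linear function of the load vector. Followed backwards through the matchings it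
becomes, after step `τ`, the weighted load with the weights `weight τ`: the `k`-th row of the
mixing matrix of the steps `τ + 1, …, t` minus the uniform vector. Along the process these
weighted loads form a martingale. The allocation of the `m` items of a step is independent of the
past and adds the variance `m / n` times the squared norm of the weights, so that over all steps
it contributes exactly `V = (m / n) Υ ^ 2`. The rounding at an edge `{i, j}` adds a centred term
of size at most `|u i - u j|`; since averaging over the edge decreases the squared norm of the
weights by half of `(u i - u j) ^ 2`, the variance caused by the rounding telescopes to at most
`2` in total (`momentBounds_stateLaw`).

All increments are bounded by `√2`, and hence the fourth moment of the deviation is bounded by a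
multiple of the square of its second moment, provided that `V` is bounded below
(`MomentBounds.bind`, `MomentBounds.anticoncentration`). By the argument of Paley and Zygmund the
deviation, and with it the discrepancy, is of order at least `√V` with constant probability,
wherever the process starts. The lower bound on `V` comes from the hypothesis on `m`, as a
positive divergence is at least `1 / 6` (`le_nodeDivergence`). The same hypothesis gives
`V ≥ (2 / 3) log n`, and this turns the first bound into the second one.

Only expectations of nonnegative functions occur, so that these can be taken in `ℝ≥0∞` and need no
summability; signed sums are used just for single increments, which have finitely many values.
-/

noncomputable section

namespace LoadBalancing

/-! ### Moments of a discrete law -/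

section Moments

variable {α β : Type}

/-- The expectation of a nonnegative extended real function under a discrete law. -/
def mean (p : PMF α) (f : α → ℝ≥0∞) : ℝ≥0∞ := ∑' a, p a * f a

theorem mean_bind (p : PMF α) (q : α → PMF β) (f : β → ℝ≥0∞) :
    mean (p.bind q) f = mean p fun a => mean (q a) f := by
  simp only [mean, PMF.bind_apply, ← ENNReal.tsum_mul_left, ← ENNReal.tsum_mul_right]
  rw [ENNReal.tsum_comm]
  simp only [mul_assoc]

theorem mean_pure (a : α) (f : α → ℝ≥0∞) : mean (PMF.pure a) f = f a := by
  rw [mean, tsum_eq_single a (fun b hb => by simp [PMF.pure_apply, hb])]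
  simp

theorem mean_map (p : PMF α) (g : α → β) (f : β → ℝ≥0∞) :
    mean (p.map g) f = mean p fun a => f (g a) := by
  rw [PMF.map, mean_bind]
  simp [mean_pure]

theorem mean_add (p : PMF α) (f g : α → ℝ≥0∞) :
    mean p (fun a => f a + g a) = mean p f + mean p g := by
  simp only [mean, mul_add, ENNReal.tsum_add]

theorem mean_mul_const (p : PMF α) (f : α → ℝ≥0∞) (c : ℝ≥0∞) :
    mean p (fun a => f a * c) = mean p f * c := by
  simp only [mean, ← mul_assoc, ENNReal.tsum_mul_right]

theorem mean_const (p : PMF α) (c : ℝ≥0∞) : mean p (fun _ => c) = c := by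
  rw [mean, ENNReal.tsum_mul_right, p.tsum_coe, one_mul]

theorem mean_mono (p : PMF α) {f g : α → ℝ≥0∞} (h : ∀ a, f a ≤ g a) : mean p f ≤ mean p g :=
  ENNReal.tsum_le_tsum fun a => mul_le_mul_right (h a) _

theorem mean_indicator (p : PMF α) (s : Set α) :
    mean p (s.indicator 1) = p.toOuterMeasure s := by
  rw [PMF.toOuterMeasure_apply, mean]
  refine tsum_congr fun a => ?_
  by_cases h : a ∈ s <;> simp [h]

theorem sum_toReal_eq_one [Fintype α] (p : PMF α) : ∑ a, (p a).toReal = 1 := by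
  rw [← ENNReal.toReal_sum fun a _ => p.apply_ne_top a, ← tsum_fintype (L := .unconditional α),
    p.tsum_coe, ENNReal.toReal_one]

theorem mean_ofReal_fintype [Fintype α] (p : PMF α) {f : α → ℝ} (hf : ∀ a, 0 ≤ f a) :
    mean p (fun a => ENNReal.ofReal (f a)) = ENNReal.ofReal (∑ a, (p a).toReal * f a) := by
  rw [mean, tsum_fintype,
    ENNReal.ofReal_sum_of_nonneg fun a _ => mul_nonneg ENNReal.toReal_nonneg (hf a)]
  refine Finset.sum_congr rfl fun a _ => ?_
  rw [ENNReal.ofReal_mul ENNReal.toReal_nonneg, ENNReal.ofReal_toReal (p.apply_ne_top a)]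

/-- The value `g` of a martingale that starts in `w` has, under the law `p`, a variance between
`l` and `s` and a fourth moment as it results from bounded increments of total variance at
most `s`. The shape of the fourth-moment bound is the one that is exactly reproduced when
increments are added one after the other, see `MomentBounds.bind`. -/
structure MomentBounds (p : PMF α) (g : α → ℝ) (w l s : ℝ) : Prop where
  lower : ENNReal.ofReal (w ^ 2 + l) ≤ mean p fun a => ENNReal.ofReal (g a ^ 2)
  upper : (mean p fun a => ENNReal.ofReal (g a ^ 2)) ≤ ENNReal.ofReal (w ^ 2 + s)
  fourth : (mean p fun a => ENNReal.ofReal (g a ^ 4)) ≤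
    ENNReal.ofReal (w ^ 4 + 8 * w ^ 2 * s + 4 * s ^ 2 + 6 * s)

theorem MomentBounds.weaken {p : PMF α} {g : α → ℝ} {w l s l' s' : ℝ}
    (h : MomentBounds p g w l s) (hl : l' ≤ l) (hs₀ : 0 ≤ s) (hs : s ≤ s') :
    MomentBounds p g w l' s' where
  lower := (ENNReal.ofReal_le_ofReal (by linarith)).trans h.lower
  upper := h.upper.trans (ENNReal.ofReal_le_ofReal (by linarith))
  fourth := h.fourth.trans (ENNReal.ofReal_le_ofReal (by gcongr))

theorem momentBounds_pure (g : α → ℝ) (a : α) : MomentBounds (PMF.pure a) g (g a) 0 0 := by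
  constructor <;> simp [mean_pure]

theorem momentBounds_map {p : PMF α} {f : α → β} {g : β → ℝ} {w l s : ℝ}
    (h : MomentBounds p (fun a => g (f a)) w l s) : MomentBounds (p.map f) g w l s := by
  constructor <;> rw [mean_map]
  exacts [h.lower, h.upper, h.fourth]

/-- Moment bounds compose along a random step, the variances being added. -/
theorem MomentBounds.bind {p : PMF α} {q : α → PMF β} {f : α → ℝ} {g : β → ℝ} {w l s l' s' : ℝ}
    (hl : 0 ≤ l) (hs : 0 ≤ s) (hl' : 0 ≤ l') (hs' : 0 ≤ s')
    (hp : MomentBounds p f w l s) (hq : ∀ a, MomentBounds (q a) g (f a) l' s') :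
    MomentBounds (p.bind q) g w (l + l') (s + s') := by
  refine ⟨?_, ?_, ?_⟩ <;> rw [mean_bind]
  · calc ENNReal.ofReal (w ^ 2 + (l + l'))
        = ENNReal.ofReal (w ^ 2 + l) + ENNReal.ofReal l' := by
          rw [← ENNReal.ofReal_add (by positivity) hl', add_assoc]
      _ ≤ (mean p fun a => ENNReal.ofReal (f a ^ 2)) + mean p fun _ => ENNReal.ofReal l' := by
          rw [mean_const]
          gcongr
          exact hp.lower
      _ = mean p fun a => ENNReal.ofReal (f a ^ 2 + l') := by
          rw [← mean_add]
          congr 1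
          ext a
          rw [ENNReal.ofReal_add (by positivity) hl']
      _ ≤ _ := mean_mono p fun a => (hq a).lower
  · calc _ ≤ mean p fun a => ENNReal.ofReal (f a ^ 2 + s') := mean_mono p fun a => (hq a).upper
      _ = (mean p fun a => ENNReal.ofReal (f a ^ 2)) + mean p fun _ => ENNReal.ofReal s' := by
          rw [← mean_add]
          congr 1
          ext a
          rw [ENNReal.ofReal_add (by positivity) hs']
      _ ≤ ENNReal.ofReal (w ^ 2 + s) + ENNReal.ofReal s' := by
          rw [mean_const]
          gcongr
          exact hp.upper
      _ = _ := by rw [← ENNReal.ofReal_add (by positivity) hs', add_assoc]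
  · calc _ ≤ mean p fun a => ENNReal.ofReal (f a ^ 4 + 8 * f a ^ 2 * s' + 4 * s' ^ 2 + 6 * s') :=
          mean_mono p fun a => (hq a).fourth
      _ = mean p (fun a => ENNReal.ofReal (f a ^ 4))
            + mean p (fun a => ENNReal.ofReal (f a ^ 2)) * ENNReal.ofReal (8 * s')
            + mean p fun _ => ENNReal.ofReal (4 * s' ^ 2 + 6 * s') := by
          rw [← mean_mul_const, ← mean_add, ← mean_add]
          congr 1
          ext a
          rw [← ENNReal.ofReal_mul (by positivity), ← ENNReal.ofReal_add (by positivity)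
            (by positivity), ← ENNReal.ofReal_add (by positivity) (by positivity)]
          congr 1
          ring
      _ ≤ ENNReal.ofReal (w ^ 4 + 8 * w ^ 2 * s + 4 * s ^ 2 + 6 * s)
            + ENNReal.ofReal (w ^ 2 + s) * ENNReal.ofReal (8 * s')
            + ENNReal.ofReal (4 * s' ^ 2 + 6 * s') := by
          rw [mean_const]
          gcongr
          exacts [hp.fourth, hp.upper]
      _ = _ := by
          rw [← ENNReal.ofReal_mul (by positivity), ← ENNReal.ofReal_add (by positivity)
            (by positivity), ← ENNReal.ofReal_add (by positivity) (by positivity)]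
          congr 1
          ring

/-- A single centred increment that is bounded by `√2`. -/
theorem momentBounds_add_centred [Fintype α] (p : PMF α) (g : α → ℝ) (w : ℝ)
    (h0 : ∑ a, (p a).toReal * g a = 0) (hg : ∀ a, g a ^ 2 ≤ 2) :
    MomentBounds p (fun a => w + g a) w (∑ a, (p a).toReal * g a ^ 2)
      (∑ a, (p a).toReal * g a ^ 2) := by
  have hsq : ∑ a, (p a).toReal * (w + g a) ^ 2 = w ^ 2 + ∑ a, (p a).toReal * g a ^ 2 := by
    calc _ = (∑ a, (p a).toReal) * w ^ 2 + (∑ a, (p a).toReal * g a) * (2 * w)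
          + ∑ a, (p a).toReal * g a ^ 2 := by
          simp only [Finset.sum_mul, ← Finset.sum_add_distrib]
          exact Finset.sum_congr rfl fun a _ => by ring
      _ = _ := by rw [sum_toReal_eq_one, h0]; ring
  have hmean := mean_ofReal_fintype p (f := fun a => (w + g a) ^ 2) fun a => sq_nonneg _
  rw [hsq] at hmean
  refine ⟨hmean.ge, hmean.le, ?_⟩
  rw [mean_ofReal_fintype p fun a => by positivity]
  refine ENNReal.ofReal_le_ofReal ?_
  set v := ∑ a, (p a).toReal * g a ^ 2
  calc ∑ a, (p a).toReal * (w + g a) ^ 4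
      ≤ ∑ a, (p a).toReal * (w ^ 4 + 4 * w ^ 3 * g a + (8 * w ^ 2 + 6) * g a ^ 2) := by
        refine Finset.sum_le_sum fun a _ => mul_le_mul_of_nonneg_left ?_ ENNReal.toReal_nonneg
        -- the cubic term is absorbed by the neighbouring even ones, and `g ^ 4 ≤ 2 g ^ 2`
        nlinarith [mul_nonneg (sq_nonneg (g a)) (sq_nonneg (w - g a)),
          mul_nonneg (sq_nonneg (g a)) (sub_nonneg.2 (hg a))]
    _ = (∑ a, (p a).toReal) * w ^ 4 + (∑ a, (p a).toReal * g a) * (4 * w ^ 3)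
          + v * (8 * w ^ 2 + 6) := by
        simp only [v, Finset.sum_mul, ← Finset.sum_add_distrib]
        exact Finset.sum_congr rfl fun a _ => by ring
    _ ≤ _ := by
        rw [sum_toReal_eq_one, h0]
        nlinarith [sq_nonneg v]

/-- The Paley–Zygmund argument: the fourth moment of the value being at most a constant multiple
of the square of its second moment, the value is not small with constant probability. -/
theorem MomentBounds.anticoncentration {p : PMF α} {g : α → ℝ} {w V s : ℝ}
    (h : MomentBounds p g w V s) (hV : 1 / 4 ≤ V) (hs₀ : 0 ≤ s) (hs : s ≤ V + 2) :
    ENNReal.ofReal (1 / 2160) ≤ p.toOuterMeasure {a | V / 2 ≤ g a ^ 2} := by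
  set A : Set α := {a | V / 2 ≤ g a ^ 2}
  set μ := w ^ 2 + V with hμ
  have hμ0 : 0 < μ := by positivity
  have hs9 : s ≤ 9 * V := by linarith
  have h4 : w ^ 4 + 8 * w ^ 2 * s + 4 * s ^ 2 + 6 * s ≤ 540 * μ ^ 2 := by
    nlinarith [mul_le_mul_of_nonneg_left hs9 (sq_nonneg w), sq_nonneg w,
      mul_le_mul hs9 hs9 hs₀ (by linarith), mul_nonneg (sq_nonneg w) (by linarith : 0 ≤ V),
      mul_nonneg (sub_nonneg.2 hV) (by linarith : 0 ≤ V), sq_nonneg (w ^ 2)]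
  -- `z ≤ b z ^ 2 + 1 / (4 b)` for `z = g ^ 2` on `A`, with `b = 1 / (2160 μ)`
  have key : ∀ a, ENNReal.ofReal (g a ^ 2) ≤ ENNReal.ofReal (μ / 2)
      + ENNReal.ofReal (g a ^ 4) * ENNReal.ofReal (1 / (2160 * μ))
      + A.indicator 1 a * ENNReal.ofReal (540 * μ) := by
    intro a
    by_cases ha : a ∈ A
    · rw [Set.indicator_of_mem ha, Pi.one_apply, one_mul, ← ENNReal.ofReal_mul (by positivity),
        ← ENNReal.ofReal_add (by positivity) (by positivity),
        ← ENNReal.ofReal_add (by positivity) (by positivity)]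
      refine ENNReal.ofReal_le_ofReal ?_
      have : 0 ≤ (g a ^ 2 - 1080 * μ) ^ 2 * (1 / (2160 * μ)) := by positivity
      have e : (g a ^ 2 - 1080 * μ) ^ 2 * (1 / (2160 * μ))
          = g a ^ 4 * (1 / (2160 * μ)) - g a ^ 2 + 540 * μ := by
        field_simp
        ring
      linarith
    · refine (ENNReal.ofReal_le_ofReal ?_).trans (le_self_add.trans le_self_add)
      have : g a ^ 2 < V / 2 := not_le.1 ha
      nlinarith [sq_nonneg w]
  have h1 := h.lower.trans (mean_mono p key)
  rw [mean_add, mean_add, mean_mul_const, mean_mul_const, mean_const, mean_indicator] at h1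
  have h2 : (mean p fun a => ENNReal.ofReal (g a ^ 4)) * ENNReal.ofReal (1 / (2160 * μ))
      ≤ ENNReal.ofReal (μ / 4) := by
    calc _ ≤ ENNReal.ofReal (540 * μ ^ 2) * ENNReal.ofReal (1 / (2160 * μ)) := by
          gcongr
          exact h.fourth.trans (ENNReal.ofReal_le_ofReal h4)
      _ = _ := by
          rw [← ENNReal.ofReal_mul (by positivity)]
          congr 1
          field_simp
          norm_num
  have hP : p.toOuterMeasure A ≠ ∞ := by
    rw [← mean_indicator]
    refine ne_top_of_le_ne_top ENNReal.one_ne_top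
      ((mean_mono p fun a => ?_).trans (mean_const p 1).le)
    by_cases ha : a ∈ A <;> simp [ha]
  rw [← ENNReal.ofReal_toReal hP] at h1 ⊢
  have h3 := h1.trans (add_le_add_left (add_le_add_right h2 _) _)
  rw [← ENNReal.ofReal_mul (by positivity), ← ENNReal.ofReal_add (by positivity) (by positivity),
    ← ENNReal.ofReal_add (by positivity) (by positivity),
    ENNReal.ofReal_le_ofReal_iff (by positivity)] at h3
  refine ENNReal.ofReal_le_ofReal ?_
  by_contra hc
  nlinarith [mul_lt_mul_of_pos_right (not_le.1 hc) hμ0]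

end Moments

/-! ### Independent coordinates -/

section Product

variable {α : Type} [Fintype α]

theorem piPMF_apply {ι : Type} [Fintype ι] [DecidableEq ι] (p : ι → PMF α) (f : ι → α) :
    piPMF p f = ∏ i, p i (f i) := rfl

theorem piPMF_fin_succ {k : ℕ} (p : Fin (k + 1) → PMF α) :
    piPMF p = (p 0).bind fun a => (piPMF fun i => p i.succ).map (Fin.cons a) := by
  ext f
  rw [piPMF_apply, PMF.bind_apply, tsum_eq_single (f 0), Fin.prod_univ_succ, PMF.map_apply,
    tsum_eq_single (Fin.tail f)]
  · simp [piPMF_apply, Fin.tail]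
  · intro g hg
    refine if_neg fun h => hg ?_
    rw [h, Fin.tail_cons]
  · intro a ha
    rw [PMF.map_apply, ENNReal.tsum_eq_zero.2, mul_zero]
    intro g
    refine if_neg fun h => ha ?_
    rw [h, Fin.cons_zero]

theorem piPMF_reindex {ι κ : Type} [Fintype ι] [DecidableEq ι] [Fintype κ] [DecidableEq κ]
    (e : ι ≃ κ) (p : ι → PMF α) :
    piPMF p = (piPMF fun k => p (e.symm k)).map fun f i => f (e i) := by
  ext f
  rw [PMF.map_apply, tsum_eq_single fun k => f (e.symm k)]
  · simp only [Equiv.symm_apply_apply, if_true, piPMF_apply]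
    exact (Equiv.prod_comp e.symm fun i => p i (f i)).symm
  · intro g hg
    refine if_neg fun h => hg ?_
    ext k
    simp [h]

theorem uniform_eq_piPMF {m : ℕ} [Nonempty α] :
    PMF.uniformOfFintype (Fin m → α) = piPMF fun _ => PMF.uniformOfFintype α := by
  ext f
  simp [piPMF_apply, PMF.uniformOfFintype_apply, ENNReal.inv_pow]

theorem momentBounds_piPMF_fin {k : ℕ} (p : Fin k → PMF α) (g : Fin k → α → ℝ) (w : ℝ)
    (h0 : ∀ i, ∑ a, (p i a).toReal * g i a = 0) (hg : ∀ i a, g i a ^ 2 ≤ 2) :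
    MomentBounds (piPMF p) (fun f => w + ∑ i, g i (f i)) w
      (∑ i, ∑ a, (p i a).toReal * g i a ^ 2) (∑ i, ∑ a, (p i a).toReal * g i a ^ 2) := by
  have hnn : ∀ (q : PMF α) (h : α → ℝ), 0 ≤ ∑ a, (q a).toReal * h a ^ 2 := fun q h =>
    Finset.sum_nonneg fun a _ => by positivity
  induction k generalizing w with
  | zero =>
    have h1 : ∀ F : (Fin 0 → α) → ℝ≥0∞, mean (piPMF p) F = F (fun i => i.elim0) := by
      intro F
      rw [mean, tsum_fintype, Fintype.sum_unique, piPMF_apply]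
      simp
      rfl
    constructor <;> simp [h1]
  | succ k ih =>
    rw [piPMF_fin_succ, Fin.sum_univ_succ]
    have hs : 0 ≤ ∑ i : Fin k, ∑ a, (p i.succ a).toReal * g i.succ a ^ 2 :=
      Finset.sum_nonneg fun i _ => hnn _ _
    refine MomentBounds.bind (hnn _ _) (hnn _ _) hs hs
      (momentBounds_add_centred (p 0) (g 0) w (h0 0) (hg 0)) fun a => momentBounds_map ?_
    simp only [Fin.sum_univ_succ, Fin.cons_zero, Fin.cons_succ, ← add_assoc]
    exact ih (fun i => p i.succ) (fun i => g i.succ) (w + g 0 a) (fun i => h0 _) fun i => hg _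

theorem momentBounds_piPMF {ι : Type} [Fintype ι] [DecidableEq ι] (p : ι → PMF α)
    (g : ι → α → ℝ) (w : ℝ) (h0 : ∀ i, ∑ a, (p i a).toReal * g i a = 0)
    (hg : ∀ i a, g i a ^ 2 ≤ 2) :
    MomentBounds (piPMF p) (fun f => w + ∑ i, g i (f i)) w
      (∑ i, ∑ a, (p i a).toReal * g i a ^ 2) (∑ i, ∑ a, (p i a).toReal * g i a ^ 2) := by
  have e := Fintype.equivFin ι
  have h := momentBounds_piPMF_fin (fun k => p (e.symm k)) (fun k => g (e.symm k)) w
    (fun k => h0 _) fun k => hg _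
  rw [Equiv.sum_comp e.symm fun i => ∑ a, (p i a).toReal * g i a ^ 2] at h
  rw [piPMF_reindex e p]
  refine momentBounds_map ?_
  convert h using 3 with f
  rw [← Equiv.sum_comp e.symm]
  simp

end Product

/-! ### The rounding error of a balancing step -/

section Rounding

variable {n : ℕ} {G : SimpleGraph (Fin n)}

theorem sum_sym2_eq_half (f : Sym2 (Fin n) → ℝ) (hf : ∀ i, f s(i, i) = 0) :
    ∑ e, f e = (∑ i, ∑ j, f s(i, j)) / 2 := by
  have h1 : ∑ e, f e = ∑ i, ∑ j, if i < j then f s(i, j) else 0 := by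
    have h := Finset.sum_sym2_filter_not_isDiag (Finset.univ : Finset (Fin n)) f
    rw [Finset.sum_filter_of_ne, Finset.sym2_univ] at h
    · rw [h, ← Fintype.sum_prod_type' (f := fun i j => if i < j then f s(i, j) else 0),
        ← Finset.sum_filter]
      refine Finset.sum_congr ?_ fun _ _ => rfl
      ext ⟨i, j⟩
      simp only [Finset.mem_filter, Finset.mem_offDiag, Finset.mem_univ, true_and]
      exact ⟨fun h => h.2, fun h => ⟨h.ne, h⟩⟩
    · intro e _ he hd
      induction e with | _ i j => ?_
      rw [Sym2.mk_isDiag_iff] at hd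
      exact he (hd ▸ hf i)
  have h2 : ∑ i, ∑ j, f s(i, j) = ∑ i, ∑ j, ((if i < j then f s(i, j) else 0)
      + if j < i then f s(j, i) else 0) := by
    refine Finset.sum_congr rfl fun i _ => Finset.sum_congr rfl fun j _ => ?_
    rcases lt_trichotomy i j with h | h | h
    · simp [h, h.not_gt]
    · simp [h, hf]
    · simp [h, h.not_gt, Sym2.eq_swap]
  rw [h2]
  simp only [Finset.sum_add_distrib]
  rw [Finset.sum_comm (f := fun i j => if j < i then f s(j, i) else 0), ← h1]
  ring

open Classical in
theorem sum_mul_sum_adj_of_antisymm (M : G.Subgraph) (u : Fin n → ℝ) (h : Fin n → Fin n → ℝ)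
    (hh : ∀ i j, h j i = -h i j) :
    ∑ i, u i * ∑ j with M.Adj i j, h i j
      = (∑ i, ∑ j, if M.Adj i j then (u i - u j) * h i j else 0) / 2 := by
  have e1 : ∑ i, u i * ∑ j with M.Adj i j, h i j
      = ∑ i, ∑ j, if M.Adj i j then u i * h i j else 0 := by
    simp only [Finset.sum_filter, Finset.mul_sum, mul_ite, mul_zero]
  have e2 : (∑ i, ∑ j, if M.Adj i j then u j * h i j else 0)
      = -∑ i, ∑ j, if M.Adj i j then u i * h i j else 0 := by
    rw [Finset.sum_comm, ← Finset.sum_neg_distrib]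
    refine Finset.sum_congr rfl fun i _ => ?_
    rw [← Finset.sum_neg_distrib]
    refine Finset.sum_congr rfl fun j _ => ?_
    simp only [M.adj_comm j i, hh i j]
    split_ifs <;> ring
  have e3 : (∑ i, ∑ j, if M.Adj i j then (u i - u j) * h i j else 0)
      = (∑ i, ∑ j, if M.Adj i j then u i * h i j else 0)
        - ∑ i, ∑ j, if M.Adj i j then u j * h i j else 0 := by
    simp only [← Finset.sum_sub_distrib]
    refine Finset.sum_congr rfl fun i _ => Finset.sum_congr rfl fun j _ => ?_
    split_ifs <;> ring
  rw [e3, e2, e1]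
  ring

open Classical in
theorem mixMatrix_mulVec {M : G.Subgraph} (hM : M.IsMatching) (u : Fin n → ℝ) (i : Fin n) :
    (mixMatrix 1 M).mulVec u i = u i - (∑ j with M.Adj i j, (u i - u j)) / 2 := by
  have hdeg : (∑ j with M.Adj i j, (1 : ℝ)) = if i ∈ M.verts then 1 else 0 := by
    split_ifs with hi
    · obtain ⟨j, hj, huniq⟩ := hM hi
      rw [Finset.sum_filter, Finset.sum_eq_single j] <;> simp_all
      exact fun b hb hbj => hb (huniq b hbj)
    · refine Finset.sum_eq_zero fun j hj => ?_
      exact absurd (M.edge_vert (Finset.mem_filter.1 hj).2) hi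
  have hsplit : ∀ j, mixMatrix 1 M i j * u j
      = (if i = j then (1 - (if i ∈ M.verts then 1 else 0) / 2) * u j else 0)
        + if M.Adj i j then u j / 2 else 0 := by
    intro j
    simp only [mixMatrix, Matrix.of_apply]
    by_cases hij : i = j
    · subst hij
      have : ¬M.Adj i i := M.loopless.irrefl i
      simp only [if_true, this, if_false, add_zero]
      split_ifs <;> ring
    · simp only [hij, if_false]
      split_ifs <;> ring
  simp only [Matrix.mulVec, dotProduct, hsplit, Finset.sum_add_distrib, Finset.sum_sub_distrib]
  rw [Finset.sum_ite_eq, ← hdeg, ← Finset.sum_filter, ← Finset.sum_div]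
  have : (∑ j with M.Adj i j, u i) = (∑ j with M.Adj i j, (1 : ℝ)) * u i := by
    rw [Finset.sum_mul]
    simp only [one_mul]
  simp only [Finset.mem_univ, if_true]
  rw [this]
  ring

open Classical in
/-- A balancing step decreases the squared norm by half of the sum, over the edges of the matching,
of the squared differences. (The double sum counts every edge twice.) -/
theorem sum_sq_mixMatrix_mulVec {M : G.Subgraph} (hM : M.IsMatching) (u : Fin n → ℝ) :
    ∑ i, (mixMatrix 1 M).mulVec u i ^ 2
      = ∑ i, u i ^ 2 - (∑ i, ∑ j, if M.Adj i j then (u i - u j) ^ 2 else 0) / 4 := by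
  -- every node has at most one neighbour in the matching
  have hsq : ∀ i, (∑ j with M.Adj i j, (u i - u j)) ^ 2 = ∑ j with M.Adj i j, (u i - u j) ^ 2 := by
    intro i
    by_cases h : ∃ j, M.Adj i j
    · obtain ⟨j, hj⟩ := h
      have : (Finset.univ.filter fun j => M.Adj i j) = {j} := by
        ext b
        simp only [Finset.mem_filter, Finset.mem_univ, true_and, Finset.mem_singleton]
        exact ⟨fun hb => hM.eq_of_adj_left hb hj, fun hb => hb ▸ hj⟩
      rw [this, Finset.sum_singleton, Finset.sum_singleton]
    · have : (Finset.univ.filter fun j => M.Adj i j) = ∅ := by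
        ext b
        simpa using fun hb => h ⟨b, hb⟩
      simp [this]
  have hanti := sum_mul_sum_adj_of_antisymm M u (fun i j => u i - u j) fun i j => by ring
  have e : ∀ i, (mixMatrix 1 M).mulVec u i ^ 2 = u i ^ 2
      - u i * (∑ j with M.Adj i j, (u i - u j)) + (∑ j with M.Adj i j, (u i - u j) ^ 2) / 4 := by
    intro i
    rw [mixMatrix_mulVec hM, ← hsq]
    ring
  simp only [e]
  rw [Finset.sum_add_distrib, Finset.sum_sub_distrib, ← Finset.sum_div, hanti]
  simp only [Finset.sum_filter, ← pow_two]
  ring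

theorem sum_sq_mixMatrix_mulVec_le {M : G.Subgraph} (hM : M.IsMatching) (u : Fin n → ℝ) :
    ∑ i, (mixMatrix 1 M).mulVec u i ^ 2 ≤ ∑ i, u i ^ 2 := by
  classical
  rw [sum_sq_mixMatrix_mulVec hM]
  refine sub_le_self _ (div_nonneg ?_ (by norm_num))
  exact Finset.sum_nonneg fun i _ => Finset.sum_nonneg fun j _ => by split_ifs <;> positivity

theorem sum_mixMatrix_mulVec {M : G.Subgraph} (hM : M.IsMatching) (u : Fin n → ℝ) :
    ∑ i, (mixMatrix 1 M).mulVec u i = ∑ i, u i := by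
  classical
  have h := sum_mul_sum_adj_of_antisymm M (fun _ => 1) (fun i j => u i - u j) fun i j => by ring
  simp only [one_mul, sub_self, zero_mul, ite_self, Finset.sum_const_zero, zero_div] at h
  simp only [mixMatrix_mulVec hM, Finset.sum_sub_distrib, ← Finset.sum_div] at h ⊢
  rw [h]
  ring

/-- The deviation of the load that `i` really loses to `j` from the ideal flow, if the coin of the
edge shows `b`. -/
def edgeError (y : Fin n → ℝ) (i j : Fin n) (b : Bool) : ℝ :=
  (y i - y j) / 2 - ((if y j ≤ y i then roundFlow (idealFlow 1 y s(i, j)) b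
    else -roundFlow (idealFlow 1 y s(i, j)) b : ℤ) : ℝ)

theorem edgeError_of_le {y : Fin n → ℝ} {i j : Fin n} (h : y j ≤ y i) (b : Bool) :
    edgeError y i j b = (y i - y j) / 2 - roundFlow ((y i - y j) / 2) b := by
  have : idealFlow 1 y s(i, j) = (y i - y j) / 2 := by
    simp [idealFlow, abs_of_nonneg (sub_nonneg.2 h)]
  rw [edgeError, if_pos h, this]

theorem edgeError_antisymm (y : Fin n → ℝ) (i j : Fin n) (b : Bool) :
    edgeError y j i b = -edgeError y i j b := by
  rcases lt_trichotomy (y i) (y j) with h | h | h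
  · simp only [edgeError, h.not_ge, h.le, if_true, if_false, Sym2.eq_swap (a := i)]
    push_cast
    ring
  · rw [edgeError_of_le h.le, edgeError_of_le h.ge, h]
    cases b <;> simp [roundFlow]
  · simp only [edgeError, h.not_ge, h.le, if_true, if_false, Sym2.eq_swap (a := i)]
    push_cast
    ring

theorem edgeError_centred (y : Fin n → ℝ) (i j : Fin n) :
    ∑ b, (fractCoin (idealFlow 1 y s(i, j)) b).toReal * edgeError y i j b = 0 := by
  wlog h : y j ≤ y i generalizing i j
  · have := this j i (not_le.1 h).le
    rw [Sym2.eq_swap]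
    simpa only [edgeError_antisymm y i j, mul_neg, Finset.sum_neg_distrib, neg_eq_zero] using this
  simp only [edgeError_of_le h]
  have : idealFlow 1 y s(i, j) = (y i - y j) / 2 := by
    simp [idealFlow, abs_of_nonneg (sub_nonneg.2 h)]
  rw [this]
  set δ := (y i - y j) / 2
  have h1 := Int.fract_lt_one δ
  have h2 : ((fractCoin δ) true).toReal = Int.fract δ := by
    simp [fractCoin, PMF.ofFintype_apply]
  have h3 : ((fractCoin δ) false).toReal = 1 - Int.fract δ := by
    simp [fractCoin, PMF.ofFintype_apply, h1.le]
  rw [Fintype.sum_bool, h2, h3]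
  simp only [roundFlow, if_true, Bool.false_eq_true, if_false]
  have h4 := Int.self_sub_floor δ
  rcases Int.fract_eq_zero_or_add_one_sub_ceil δ with h5 | h5
  · rw [h4, h5]
    ring
  · rw [h4, show δ - ⌈δ⌉ = Int.fract δ - 1 by linarith]
    ring

theorem edgeError_sq_le_one (y : Fin n → ℝ) (i j : Fin n) (b : Bool) :
    edgeError y i j b ^ 2 ≤ 1 := by
  wlog h : y j ≤ y i generalizing i j
  · have := this j i (not_le.1 h).le
    rwa [edgeError_antisymm y i j, neg_sq] at this
  rw [edgeError_of_le h, sq_le_one_iff_abs_le_one, abs_le]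
  have h1 := Int.floor_le ((y i - y j) / 2)
  have h2 := Int.lt_floor_add_one ((y i - y j) / 2)
  have h3 := Int.le_ceil ((y i - y j) / 2)
  have h4 := Int.ceil_lt_add_one ((y i - y j) / 2)
  cases b <;> simp only [roundFlow, if_true, Bool.false_eq_true, if_false] <;>
    constructor <;> linarith

open Classical in
/-- The contribution of the rounding at an edge to the load weighted with `u`, as a function of the
coin of the edge. It is zero for pairs that are not in the matching. -/
def edgeNoise (M : G.Subgraph) (u y : Fin n → ℝ) (e : Sym2 (Fin n)) (b : Bool) : ℝ :=
  Sym2.lift ⟨fun i j => if M.Adj i j then (u i - u j) * edgeError y i j b else 0, fun i j => by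
    simp only [M.adj_comm j i, edgeError_antisymm y i j]
    split_ifs <;> ring⟩ e

open Classical in
theorem edgeNoise_mk (M : G.Subgraph) (u y : Fin n → ℝ) (i j : Fin n) (b : Bool) :
    edgeNoise M u y s(i, j) b = if M.Adj i j then (u i - u j) * edgeError y i j b else 0 := rfl

/-- The weighted load after a balancing step: the ideal step may be applied to the weights, as its
matrix is symmetric, and the rounding adds one independent term per edge. -/
theorem sum_mul_balanced {M : G.Subgraph} (hM : M.IsMatching) (u y : Fin n → ℝ)
    (ω : Sym2 (Fin n) → Bool) :
    ∑ i, u i * balanced 1 M y ω i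
      = ∑ i, (mixMatrix 1 M).mulVec u i * y i + ∑ e, edgeNoise M u y e (ω e) := by
  classical
  have hb : ∀ i, balanced 1 M y ω i = y i - (∑ j with M.Adj i j, (y i - y j)) / 2
      + ∑ j with M.Adj i j, edgeError y i j (ω s(i, j)) := by
    intro i
    simp only [edgeError, Finset.sum_sub_distrib, ← Finset.sum_div, balanced, signedFlow]
    ring
  have h1 := sum_mul_sum_adj_of_antisymm M u (fun i j => y i - y j) fun i j => by ring
  have h2 := sum_mul_sum_adj_of_antisymm M y (fun i j => u i - u j) fun i j => by ring
  have h3 := sum_mul_sum_adj_of_antisymm M u (fun i j => edgeError y i j (ω s(i, j)))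
    fun i j => by rw [edgeError_antisymm y i j, Sym2.eq_swap]
  have h4 := sum_sym2_eq_half (fun e => edgeNoise M u y e (ω e)) fun i => by
    simp [edgeNoise_mk]
  simp only [edgeNoise_mk] at h4
  rw [h4, ← h3]
  have h5 : ∑ i, u i * ∑ j with M.Adj i j, (y i - y j)
      = ∑ i, y i * ∑ j with M.Adj i j, (u i - u j) := by
    rw [h1, h2]
    simp only [mul_comm]
  have e1 : ∑ i, u i * balanced 1 M y ω i = ∑ i, u i * y i
      - (∑ i, u i * ∑ j with M.Adj i j, (y i - y j)) / 2
      + ∑ i, u i * ∑ j with M.Adj i j, edgeError y i j (ω s(i, j)) := by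
    rw [Finset.sum_div, ← Finset.sum_sub_distrib, ← Finset.sum_add_distrib]
    refine Finset.sum_congr rfl fun i _ => ?_
    rw [hb]
    ring
  have e2 : ∑ i, (mixMatrix 1 M).mulVec u i * y i = ∑ i, u i * y i
      - (∑ i, y i * ∑ j with M.Adj i j, (u i - u j)) / 2 := by
    rw [Finset.sum_div, ← Finset.sum_sub_distrib]
    refine Finset.sum_congr rfl fun i _ => ?_
    rw [mixMatrix_mulVec hM]
    ring
  rw [e1, e2, h5]

/-- The rounding in one step adds to the weighted load a variance of at most twice the decrease of
the squared norm of the weights. -/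
theorem momentBounds_balanceLaw {M : G.Subgraph} (hM : M.IsMatching) (u y : Fin n → ℝ)
    (hu : ∑ i, u i ^ 2 ≤ 1) :
    MomentBounds (balanceLaw 1 M y) (fun z => ∑ i, u i * z i)
      (∑ i, (mixMatrix 1 M).mulVec u i * y i) 0
      (2 * (∑ i, u i ^ 2 - ∑ i, (mixMatrix 1 M).mulVec u i ^ 2)) := by
  classical
  have hdiff : ∀ i j, M.Adj i j → (u i - u j) ^ 2 ≤ 2 := by
    intro i j hij
    have : u i ^ 2 + u j ^ 2 ≤ ∑ i, u i ^ 2 := by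
      rw [← Finset.sum_pair hij.ne (f := fun i => u i ^ 2)]
      exact Finset.sum_le_sum_of_subset_of_nonneg (Finset.subset_univ _)
        fun i _ _ => sq_nonneg _
    nlinarith [sq_nonneg (u i + u j)]
  have h := momentBounds_piPMF (fun e : Sym2 (Fin n) => fractCoin (idealFlow 1 y e))
    (edgeNoise M u y) (∑ i, (mixMatrix 1 M).mulVec u i * y i) ?_ ?_
  · refine momentBounds_map ?_
    simp only [sum_mul_balanced hM]
    have hnn : ∀ e, 0 ≤ ∑ b, (fractCoin (idealFlow 1 y e) b).toReal * edgeNoise M u y e b ^ 2 :=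
      fun e => Finset.sum_nonneg fun b _ => by positivity
    refine h.weaken (Finset.sum_nonneg fun e _ => hnn e) (Finset.sum_nonneg fun e _ => hnn e) ?_
    rw [sum_sym2_eq_half _ fun i => by simp [edgeNoise_mk], sum_sq_mixMatrix_mulVec hM]
    have : ∑ i, ∑ j, ∑ b, (fractCoin (idealFlow 1 y s(i, j)) b).toReal
          * edgeNoise M u y s(i, j) b ^ 2
        ≤ ∑ i, ∑ j, if M.Adj i j then (u i - u j) ^ 2 else 0 := by
      refine Finset.sum_le_sum fun i _ => Finset.sum_le_sum fun j _ => ?_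
      have hone : (if M.Adj i j then (u i - u j) ^ 2 else 0)
          = ∑ b, (fractCoin (idealFlow 1 y s(i, j)) b).toReal
            * if M.Adj i j then (u i - u j) ^ 2 else 0 := by
        rw [← Finset.sum_mul, sum_toReal_eq_one, one_mul]
      rw [hone]
      refine Finset.sum_le_sum fun b _ => mul_le_mul_of_nonneg_left ?_ ENNReal.toReal_nonneg
      rw [edgeNoise_mk]
      split_ifs
      · rw [mul_pow]
        exact mul_le_of_le_one_right (sq_nonneg _) (edgeError_sq_le_one ..)
      · simp
    linarith
  · intro e
    induction e with | _ i j => ?_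
    simp only [edgeNoise_mk]
    split_ifs
    · simp only [mul_left_comm _ (u i - u j), ← Finset.mul_sum, edgeError_centred, mul_zero]
    · simp
  · intro e b
    induction e with | _ i j => ?_
    rw [edgeNoise_mk]
    split_ifs with hij
    · rw [mul_pow]
      exact (mul_le_of_le_one_right (sq_nonneg _) (edgeError_sq_le_one ..)).trans (hdiff i j hij)
    · norm_num

end Rounding

/-! ### The weighted load along the process -/

section Evolution

variable {n : ℕ} [NeZero n] {G : SimpleGraph (Fin n)}

theorem momentBounds_allocLaw (m : ℕ) (u : Fin n → ℝ) (w : ℝ) (hu₀ : ∑ i, u i = 0)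
    (hu : ∑ i, u i ^ 2 ≤ 1) :
    MomentBounds (allocLaw n m) (fun l => w + ∑ i, u i * l i) w
      ((m : ℝ) / n * ∑ i, u i ^ 2) ((m : ℝ) / n * ∑ i, u i ^ 2) := by
  classical
  refine momentBounds_map ?_
  have hsum : ∀ a : Fin m → Fin n, ∑ i, u i * allocVec a i = ∑ j, u (a j) := by
    intro a
    rw [← Finset.sum_fiberwise (s := Finset.univ) (g := a)]
    refine Finset.sum_congr rfl fun i _ => ?_
    rw [Finset.sum_congr rfl (g := fun _ => u i) fun j hj => by rw [(Finset.mem_filter.1 hj).2],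
      Finset.sum_const, nsmul_eq_mul, mul_comm]
    simp only [allocVec]
  have h := momentBounds_piPMF (fun _ : Fin m => PMF.uniformOfFintype (Fin n)) (fun _ => u) w
    (fun _ => by
      simp only [PMF.uniformOfFintype_apply, ← Finset.mul_sum, hu₀, mul_zero])
    (fun _ i => ((Finset.single_le_sum (f := fun i => u i ^ 2) (fun i _ => sq_nonneg _)
      (Finset.mem_univ i)).trans hu).trans one_le_two)
  rw [uniform_eq_piPMF]
  simp only [hsum]
  convert h using 1 <;>
  · simp only [PMF.uniformOfFintype_apply, ← Finset.mul_sum, Finset.sum_const, Finset.card_univ,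
      Fintype.card_fin, nsmul_eq_mul, ENNReal.toReal_inv, ENNReal.toReal_natCast]
    ring

/-- If the weights of the single steps arise from each other by applying the matching of the step
in between, the weighted load is a martingale. Its variance comes from the allocation, up to the
rounding, the contribution of which telescopes. -/
theorem momentBounds_stateLaw (M : ℕ → G.Subgraph) (hM : ∀ τ, (M τ).IsMatching) (m T : ℕ)
    (x₀ : Fin n → ℝ) (u : ℕ → Fin n → ℝ)
    (hstep : ∀ τ < T, u τ = (mixMatrix 1 (M (τ + 1))).mulVec (u (τ + 1)))
    (hu₀ : ∀ τ ≤ T, ∑ i, u τ i = 0) (hu : ∀ τ ≤ T, ∑ i, u τ i ^ 2 ≤ 1) :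
    ∀ τ ≤ T, MomentBounds (stateLaw 1 m M x₀ τ) (fun x => ∑ i, u τ i * x i) (∑ i, u 0 i * x₀ i)
      ((m : ℝ) / n * ∑ σ ∈ Finset.range τ, ∑ i, u σ i ^ 2)
      ((m : ℝ) / n * (∑ σ ∈ Finset.range τ, ∑ i, u σ i ^ 2)
        + 2 * (∑ i, u τ i ^ 2 - ∑ i, u 0 i ^ 2)) := by
  have hmono : ∀ τ < T, ∑ i, u τ i ^ 2 ≤ ∑ i, u (τ + 1) i ^ 2 := by
    intro τ hτ
    rw [hstep τ hτ]
    exact sum_sq_mixMatrix_mulVec_le (hM _) _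
  have hmono₀ : ∀ τ ≤ T, ∑ i, u 0 i ^ 2 ≤ ∑ i, u τ i ^ 2 := by
    intro τ hτ
    induction τ with
    | zero => rfl
    | succ τ ih => exact (ih (by omega)).trans (hmono τ (by omega))
  have hnn : ∀ τ, 0 ≤ (m : ℝ) / n * ∑ σ ∈ Finset.range τ, ∑ i, u σ i ^ 2 := fun τ =>
    mul_nonneg (by positivity) (Finset.sum_nonneg fun σ _ => Finset.sum_nonneg fun i _ =>
      sq_nonneg _)
  intro τ hτ
  induction τ with
  | zero =>
    simpa [stateLaw] using momentBounds_pure (fun x : Fin n → ℝ => ∑ i, u 0 i * x i) x₀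
  | succ τ ih =>
    have hτ' : τ < T := by omega
    have ha : 0 ≤ (m : ℝ) / n * ∑ i, u τ i ^ 2 :=
      mul_nonneg (by positivity) (Finset.sum_nonneg fun i _ => sq_nonneg _)
    have hr : 0 ≤ 2 * (∑ i, u (τ + 1) i ^ 2 - ∑ i, u τ i ^ 2) := by
      linarith [hmono τ hτ']
    have hround : ∀ x l : Fin n → ℝ, MomentBounds (balanceLaw 1 (M (τ + 1)) (x + l))
        (fun z => ∑ i, u (τ + 1) i * z i) (∑ i, u τ i * x i + ∑ i, u τ i * l i) 0
        (2 * (∑ i, u (τ + 1) i ^ 2 - ∑ i, u τ i ^ 2)) := by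
      intro x l
      have h := momentBounds_balanceLaw (hM (τ + 1)) (u (τ + 1)) (x + l) (hu _ hτ)
      rw [← hstep τ hτ'] at h
      simpa only [Pi.add_apply, mul_add, Finset.sum_add_distrib] using h
    have h := (ih hτ'.le).bind (hnn τ) (add_nonneg (hnn τ) (by linarith [hmono₀ τ hτ'.le]))
      (add_nonneg ha le_rfl) (add_nonneg ha hr) fun x =>
        (momentBounds_allocLaw m (u τ) (∑ i, u τ i * x i) (hu₀ τ hτ'.le) (hu τ hτ'.le)).bind
          ha ha le_rfl hr (hround x)
    rw [stateLaw, Finset.sum_range_succ]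
    convert h using 1 <;> ring

end Evolution

/-! ### The weights given by the mixing matrices -/

section Weights

variable {n : ℕ} {G : SimpleGraph (Fin n)}

theorem mixProd_of_lt (M : ℕ → G.Subgraph) {τ T : ℕ} (h : T < τ) : mixProd 1 M τ T = 1 := by
  cases T with
  | zero => rfl
  | succ T => rw [mixProd, if_neg (by omega)]

theorem mixProd_eq_mul (M : ℕ → G.Subgraph) {τ T : ℕ} (h : τ < T) :
    mixProd 1 M (τ + 1) T = mixProd 1 M (τ + 2) T * mixMatrix 1 (M (τ + 1)) := by
  induction T with
  | zero => omega
  | succ T ih =>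
    rw [mixProd, if_pos (by omega)]
    rcases (Nat.lt_succ_iff.1 h).lt_or_eq with h | rfl
    · rw [ih h, mixProd, if_pos (by omega), mul_assoc]
    · rw [mixProd_of_lt M (by omega), mixProd_of_lt M (by omega), mul_one, one_mul]

theorem mixMatrix_transpose (M : G.Subgraph) : (mixMatrix 1 M).transpose = mixMatrix 1 M := by
  ext i j
  rw [Matrix.transpose_apply, mixMatrix, Matrix.of_apply, Matrix.of_apply]
  by_cases h : i = j
  · rw [h]
  · by_cases ha : M.Adj i j
    · simp [h, Ne.symm h, ha, ha.symm]
    · simp [h, Ne.symm h, ha, mt SimpleGraph.Subgraph.Adj.symm ha]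

/-- The weights of the loads after step `τ` in the deviation of the load of `k` from the average
load after step `T`. -/
def weight (M : ℕ → G.Subgraph) (T : ℕ) (k : Fin n) (τ : ℕ) (i : Fin n) : ℝ :=
  mixProd 1 M (τ + 1) T k i - 1 / n

theorem weight_self (M : ℕ → G.Subgraph) (T : ℕ) (k i : Fin n) :
    weight M T k T i = (if k = i then 1 else 0) - 1 / n := by
  rw [weight, mixProd_of_lt M (by omega), Matrix.one_apply]

theorem weight_step (M : ℕ → G.Subgraph) (hM : ∀ τ, (M τ).IsMatching) {τ T : ℕ} (k : Fin n)
    (h : τ < T) :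
    weight M T k τ = (mixMatrix 1 (M (τ + 1))).mulVec (weight M T k (τ + 1)) := by
  have hconst : ∀ i, ∑ j, mixMatrix 1 (M (τ + 1)) i j = 1 := by
    classical
    intro i
    have := mixMatrix_mulVec (hM (τ + 1)) (fun _ => 1) i
    simpa [Matrix.mulVec, dotProduct] using this
  ext i
  simp only [weight, Matrix.mulVec, dotProduct, mul_sub, Finset.sum_sub_distrib, ← Finset.sum_mul,
    hconst, one_mul]
  rw [mixProd_eq_mul M h, Matrix.mul_apply]
  congr 1
  refine Finset.sum_congr rfl fun j _ => ?_
  rw [mul_comm, ← Matrix.transpose_apply (mixMatrix _ _), mixMatrix_transpose]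

theorem sum_weight [NeZero n] (M : ℕ → G.Subgraph) (hM : ∀ τ, (M τ).IsMatching) {τ T : ℕ}
    (k : Fin n) (h : τ ≤ T) : ∑ i, weight M T k τ i = 0 := by
  induction h using Nat.decreasingInduction with
  | of_succ τ h ih => rw [weight_step M hM k h, sum_mixMatrix_mulVec (hM _), ih]
  | self =>
    have : (n : ℝ) ≠ 0 := Nat.cast_ne_zero.2 (NeZero.ne n)
    simp [weight_self, this]

theorem sum_sq_weight_le (M : ℕ → G.Subgraph) (hM : ∀ τ, (M τ).IsMatching) {τ T : ℕ}
    (k : Fin n) (h : τ ≤ T) : ∑ i, weight M T k τ i ^ 2 ≤ ∑ i, weight M T k T i ^ 2 := by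
  induction h using Nat.decreasingInduction with
  | of_succ τ h ih =>
    rw [weight_step M hM k h]
    exact (sum_sq_mixMatrix_mulVec_le (hM _) _).trans ih
  | self => rfl

theorem sum_sq_weight_self_le_one [NeZero n] (M : ℕ → G.Subgraph) (T : ℕ) (k : Fin n) :
    ∑ i, weight M T k T i ^ 2 ≤ 1 := by
  have hn : (0 : ℝ) < n := Nat.cast_pos.2 (NeZero.pos n)
  have e : ∀ i, weight M T k T i ^ 2
      = (if k = i then 1 - 2 / (n : ℝ) else 0) + (1 / (n : ℝ)) ^ 2 := by
    intro i
    rw [weight_self]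
    split_ifs <;> ring
  simp only [e, Finset.sum_add_distrib, Finset.sum_ite_eq, Finset.mem_univ, if_true,
    Finset.sum_const, Finset.card_univ, Fintype.card_fin, nsmul_eq_mul]
  have : (n : ℝ) * (1 / n) ^ 2 = 1 / n := by field_simp
  have : (0 : ℝ) < 1 / n := by positivity
  have : 2 / (n : ℝ) = 2 * (1 / n) := by ring
  linarith

theorem nodeDivergence_eq (M : ℕ → G.Subgraph) (T : ℕ) (k : Fin n) :
    nodeDivergence 1 M T k = √(∑ σ ∈ Finset.range T, ∑ i, weight M T k σ i ^ 2) := by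
  rw [nodeDivergence, Finset.range_eq_Ico, ← Finset.Ico_add_one_right_eq_Icc]
  simp only [weight]
  rw [Finset.sum_Ico_add' (fun τ => ∑ i, (mixProd 1 M τ T k i - 1 / (n : ℝ)) ^ 2), zero_add]

/-- A divergence that is not zero is bounded below by a constant: already the last step contributes
at least this much, unless there is only one node, or there are two and the last matching is the edge
between them; in these cases all contributions vanish. -/
theorem le_nodeDivergence [NeZero n] (M : ℕ → G.Subgraph) (hM : ∀ τ, (M τ).IsMatching) (T : ℕ)
    (k : Fin n) (h : 0 < nodeDivergence 1 M T k) : 1 / 6 ≤ nodeDivergence 1 M T k := by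
  classical
  rw [nodeDivergence_eq] at h ⊢
  rcases T with _ | T
  · simp at h
  have hsum := Real.sqrt_pos.1 h
  have hne : weight M (T + 1) k T ≠ 0 := by
    intro h0
    have hz : ∀ σ ≤ T, weight M (T + 1) k σ = 0 := by
      intro σ hσ
      induction hσ using Nat.decreasingInduction with
      | of_succ σ hσ ih => rw [weight_step M hM k (by omega), ih, Matrix.mulVec_zero]
      | self => exact h0
    refine hsum.ne' (Finset.sum_eq_zero fun σ hσ => ?_)
    rw [hz σ (Nat.lt_succ_iff.1 (Finset.mem_range.1 hσ))]
    simp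
  have hn : (0 : ℝ) < n := Nat.cast_pos.2 (NeZero.pos n)
  have hval : weight M (T + 1) k T k = if k ∈ (M (T + 1)).verts then 1 / 2 - 1 / (n : ℝ)
      else 1 - 1 / n := by
    rw [weight, mixProd, if_pos le_rfl, mixProd_of_lt M (Nat.lt_succ_self T), mul_one, mixMatrix,
      Matrix.of_apply, if_pos rfl]
    split_ifs <;> ring
  have hk : 1 / 6 ≤ weight M (T + 1) k T k := by
    have hs := sum_weight M hM k (Nat.le_succ T)
    have hn0 := NeZero.ne n
    rcases (show n = 1 ∨ n = 2 ∨ 3 ≤ n by omega) with rfl | rfl | hn3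
    · refine absurd (funext fun i => ?_) hne
      rw [Fin.sum_univ_one] at hs
      rw [Subsingleton.elim i 0, hs]
      rfl
    · rw [hval]
      split_ifs with hv
      · rw [if_pos hv] at hval
        refine absurd (funext fun i => ?_) hne
        norm_num at hval
        rw [Fin.sum_univ_two] at hs
        fin_cases k <;> fin_cases i <;> simp_all
      · norm_num
    · have h3 : (3 : ℝ) ≤ n := by exact_mod_cast hn3
      have : 1 / (n : ℝ) ≤ 1 / 3 := by gcongr
      rw [hval]
      split_ifs <;> linarith
  refine Real.le_sqrt_of_sq_le ?_
  calc (1 / 6 : ℝ) ^ 2 ≤ weight M (T + 1) k T k ^ 2 := by gcongr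
    _ ≤ ∑ i, weight M (T + 1) k T i ^ 2 :=
      Finset.single_le_sum (f := fun i => weight M (T + 1) k T i ^ 2) (fun i _ => sq_nonneg _)
        (Finset.mem_univ k)
    _ ≤ _ := Finset.single_le_sum (f := fun σ => ∑ i, weight M (T + 1) k σ i ^ 2)
        (fun σ _ => Finset.sum_nonneg fun i _ => sq_nonneg _) (Finset.self_mem_range_succ T)

end Weights

/-! ### The discrepancy -/

section Discrepancy

variable {n : ℕ} [NeZero n] {G : SimpleGraph (Fin n)}

theorem disc_nonneg (x : Fin n → ℝ) : 0 ≤ disc x :=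
  sub_nonneg.2 ((Finset.inf'_le x (Finset.mem_univ 0)).trans
    (Finset.le_sup' x (Finset.mem_univ 0)))

theorem abs_sum_weight_mul_le_disc (M : ℕ → G.Subgraph) (T : ℕ) (k : Fin n) (x : Fin n → ℝ) :
    |∑ i, weight M T k T i * x i| ≤ disc x := by
  have hn : (0 : ℝ) < n := Nat.cast_pos.2 (NeZero.pos n)
  have e : ∑ i, weight M T k T i * x i = (∑ i, (x k - x i)) / n := by
    simp only [weight_self, sub_mul, Finset.sum_sub_distrib, ite_mul, one_mul, zero_mul,
      Finset.sum_ite_eq, Finset.mem_univ, if_true, Finset.sum_const, Finset.card_univ,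
      Fintype.card_fin, nsmul_eq_mul, ← Finset.mul_sum]
    field_simp
  have hd : ∀ i j, x i - x j ≤ disc x := fun i j =>
    sub_le_sub (Finset.le_sup' x (Finset.mem_univ i)) (Finset.inf'_le x (Finset.mem_univ j))
  rw [e, abs_div, abs_of_pos hn, div_le_iff₀ hn]
  calc |∑ i, (x k - x i)| ≤ ∑ i, |x k - x i| := Finset.abs_sum_le_sum_abs _ _
    _ ≤ ∑ _i : Fin n, disc x := Finset.sum_le_sum fun i _ =>
        abs_le.2 ⟨by linarith [hd i k], hd k i⟩
    _ = disc x * n := by simp [mul_comm]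

/-- The discrepancy is at least a constant multiple of the standard deviation of the load of the
node with the largest divergence, with constant probability. The hypothesis on the number `m` of
items makes this standard deviation at least a constant multiple of `√(log n)`. -/
theorem disc_lower_bound (M : ℕ → G.Subgraph) (hM : ∀ τ, (M τ).IsMatching) (x₀ : Fin n → ℝ)
    (t m : ℕ) (hpos : 0 < globalDivergence 1 M t)
    (hm : 4 * (n : ℝ) * Real.log n / globalDivergence 1 M t ≤ (m : ℝ)) :
    2 / 3 * Real.log n ≤ (√((m : ℝ) / n) * globalDivergence 1 M t) ^ 2 ∧
    ENNReal.ofReal (1 / 2160) ≤ (stateLaw 1 m M x₀ t).toOuterMeasure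
      {x | (√((m : ℝ) / n) * globalDivergence 1 M t) ^ 2 / 2 ≤ disc x ^ 2} := by
  have hn : (0 : ℝ) < n := Nat.cast_pos.2 (NeZero.pos n)
  obtain ⟨k, -, hk⟩ := Finset.exists_mem_eq_sup' Finset.univ_nonempty (nodeDivergence 1 M t)
  change globalDivergence 1 M t = _ at hk
  rw [hk] at hpos hm ⊢
  set Y := nodeDivergence 1 M t k with hY
  have hY6 : 1 / 6 ≤ Y := le_nodeDivergence M hM t k hpos
  have hn2 : 2 ≤ n := by
    by_contra hlt
    obtain rfl : n = 1 := by have := NeZero.ne n; omega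
    refine hpos.ne' ?_
    rw [hY, nodeDivergence_eq, Finset.sum_eq_zero, Real.sqrt_zero]
    intro σ hσ
    have hs := sum_weight M hM k (Finset.mem_range.1 hσ).le
    rw [Fin.sum_univ_one] at hs ⊢
    rw [hs]
    norm_num
  have hlog : Real.log 2 ≤ Real.log n := Real.log_le_log (by norm_num) (by exact_mod_cast hn2)
  have hlog2 := Real.log_two_gt_d9
  have hV : (√((m : ℝ) / n) * Y) ^ 2
      = (m : ℝ) / n * ∑ σ ∈ Finset.range t, ∑ i, weight M t k σ i ^ 2 := by
    rw [mul_pow, Real.sq_sqrt (by positivity), hY, nodeDivergence_eq, Real.sq_sqrt]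
    exact Finset.sum_nonneg fun σ _ => Finset.sum_nonneg fun i _ => sq_nonneg _
  set V := (√((m : ℝ) / n) * Y) ^ 2 with hVdef
  have hVlog : 2 / 3 * Real.log n ≤ V := by
    have h1 : 4 * Real.log n / Y ≤ (m : ℝ) / n := by
      rw [le_div_iff₀ hn]
      calc _ = 4 * (n : ℝ) * Real.log n / Y := by ring
        _ ≤ m := hm
    calc 2 / 3 * Real.log n = 4 * Real.log n * (1 / 6) := by ring
      _ ≤ 4 * Real.log n * Y := by
          have : 0 ≤ Real.log n := by linarith
          gcongr
      _ = 4 * Real.log n / Y * Y ^ 2 := by field_simp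
      _ ≤ (m : ℝ) / n * Y ^ 2 := by gcongr
      _ = V := by rw [hVdef, mul_pow, Real.sq_sqrt (by positivity)]
  refine ⟨hVlog, ?_⟩
  have hb := momentBounds_stateLaw M hM m t x₀ (weight M t k) (fun τ h => weight_step M hM k h)
    (fun τ h => sum_weight M hM k h)
    (fun τ h => (sum_sq_weight_le M hM k h).trans (sum_sq_weight_self_le_one M t k)) t le_rfl
  rw [← hV] at hb
  have h0 : 0 ≤ ∑ i, weight M t k 0 i ^ 2 := Finset.sum_nonneg fun i _ => sq_nonneg _
  have hVnn : 0 ≤ V := sq_nonneg _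
  have hs₀ : 0 ≤ V + 2 * (∑ i, weight M t k t i ^ 2 - ∑ i, weight M t k 0 i ^ 2) := by
    linarith [sum_sq_weight_le M hM k (Nat.zero_le t)]
  have hb' := hb.anticoncentration (by linarith) hs₀
    (by linarith [sum_sq_weight_self_le_one M t k])
  refine hb'.trans (MeasureTheory.measure_mono fun x hx => ?_)
  refine le_trans (b := (∑ i, weight M t k t i * x i) ^ 2) hx ?_
  rw [← sq_abs]
  exact pow_le_pow_left₀ (abs_nonneg _) (abs_sum_weight_mul_le_disc M t k x) 2

end Discrepancy

end LoadBalancing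

end

theorem mainTheorem5 :
    ∃ c : ℝ, 0 < c ∧ ∃ p : ℝ, 0 < p ∧
      ∀ (n : ℕ) [NeZero n] (G : SimpleGraph (Fin n)) (ζ : ℕ) [NeZero ζ]
        (C : LoadBalancing.BalancingCircuit G ζ) (x₀ : Fin n → ℝ) (t m : ℕ),
        4 * (n : ℝ) * Real.log n / LoadBalancing.globalDivergence 1 C.seq t ≤ (m : ℝ) →
        -- the lower bound on the discrepancy
        ENNReal.ofReal p ≤ (LoadBalancing.stateLaw 1 m C.seq x₀ t).toOuterMeasure
            {x | c * (√((m : ℝ) / n) * LoadBalancing.globalDivergence 1 C.seq t)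
              ≤ LoadBalancing.disc x} ∧
        -- the upper bound of the balancing circuit model is attained up to a factor `√(log n)`
        (0 < LoadBalancing.globalDivergence 1 C.seq t →
          ENNReal.ofReal p ≤ (LoadBalancing.stateLaw 1 m C.seq x₀ t).toOuterMeasure
            {x | c * (Real.log n + √((m : ℝ) / n) * LoadBalancing.globalDivergence 1 C.seq t
                * √(Real.log n)) ≤ √(Real.log n) * LoadBalancing.disc x}) := by
  refine ⟨1 / 4, by norm_num, 1 / 2160, by norm_num, ?_⟩
  intro n _ G ζ _ C x₀ t m hm
  have hM : ∀ τ, (C.seq τ).IsMatching := fun τ => C.isMatching _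
  set Y := LoadBalancing.globalDivergence 1 C.seq t with hY
  have hY0 : 0 ≤ Y := (Real.sqrt_nonneg _).trans
    (Finset.le_sup' (LoadBalancing.nodeDivergence 1 C.seq t) (Finset.mem_univ 0))
  -- for a positive divergence this lower bound on the discrepancy contains both claims
  have key : 0 < Y → ∀ x : Fin n → ℝ, (√((m : ℝ) / n) * Y) ^ 2 / 2 ≤ LoadBalancing.disc x ^ 2 →
      1 / 4 * (√(Real.log n) + √((m : ℝ) / n) * Y) ≤ LoadBalancing.disc x := by
    intro hpos x hx
    have hlog := (LoadBalancing.disc_lower_bound C.seq hM x₀ t m hpos hm).1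
    have hd := LoadBalancing.disc_nonneg x
    set a := √((m : ℝ) / n) * Y
    have ha : 0 ≤ a := by positivity
    have h1 : √(Real.log n) ≤ 5 / 4 * a := Real.sqrt_le_iff.2 ⟨by positivity, by nlinarith⟩
    have h2 : 9 / 16 * a ≤ LoadBalancing.disc x := by
      refine abs_le_of_sq_le_sq' ?_ hd |>.2
      nlinarith
    linarith
  constructor
  · rcases hY0.eq_or_lt with h0 | hpos
    · have : {x : Fin n → ℝ | 1 / 4 * (√((m : ℝ) / n) * Y) ≤ LoadBalancing.disc x} = Set.univ := by
        ext x
        simpa [← h0] using LoadBalancing.disc_nonneg x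
      rw [this, (PMF.toOuterMeasure_apply_eq_one_iff _ _).2 (Set.subset_univ _)]
      exact ENNReal.ofReal_le_one.2 (by norm_num)
    · refine (LoadBalancing.disc_lower_bound C.seq hM x₀ t m hpos hm).2.trans
        (MeasureTheory.measure_mono fun x hx => ?_)
      have := key hpos x hx
      have := Real.sqrt_nonneg (Real.log n)
      rw [Set.mem_ofPred_eq]
      linarith
  · intro hpos
    refine (LoadBalancing.disc_lower_bound C.seq hM x₀ t m hpos hm).2.trans
      (MeasureTheory.measure_mono fun x hx => ?_)
    have h := mul_le_mul_of_nonneg_left (key hpos x hx) (Real.sqrt_nonneg (Real.log n))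
    have hs := Real.mul_self_sqrt (Real.log_natCast_nonneg n)
    rw [Set.mem_ofPred_eq]
    linear_combination h + (-(1 / 4 : ℝ)) * hs
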